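/- Let $V$ be a real vector space of finite dimension $n\ge 1$, and let $p,p'\ge 0$ be integers with $p+p'=n$. A scalar product on $V$ is a non-degenerate symmetric bilinear form $\gamma:V\times V\to\mathbb{R}$; it has signature $(p,p')$ if $V$ has a $\gamma$-orthonormal basis $(v_i)$ (i.e. $\gamma(v_i,v_j)=0$ for $i\ne j$ and $\gamma(v_i,v_i)=\pm1$) with exactly $p$ vectors satisfying $\gamma(v_i,v_i)=1$ and exactly $p'$ vectors satisfying $\gamma(v_i,v_i)=-1$. Let $\Gamma$ be the set of all scalar products on $V$ of signature $(p,p')$, with the topology induced by the coordinates $\gamma\mapsto(\gamma(v_i,v_j))_{i\le j}\in\mathbb{R}^{n(n+1)/2}$ in any basis $(v_i)$ of $V$. The group $GL(V)$ acts on $\Gamma$ by homeomorphisms, $(g\gamma)(v,v')=\gamma(g^{-1}v,g^{-1}v')$. Call a Borel measure $\mu$ on $\Gamma$ regular if it is finite on compact sets, outer regular on Borel sets (by open sets) and inner regular on open sets (by compact sets), and invariant if its pushforward under $\gamma\mapsto g\gamma$ equals $\mu$ for every $g\in GL(V)$. Then there exists a non-zero invariant regular Borel measure on $\Gamma$. It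 is unique up to a positive multiplicative constant: if $\mu$ and $\nu$ are two non-zero invariant regular Borel measures on $\Gamma$, then $\nu=c\,\mu$ for some real $c>0$. -/

import Mathlib

open MeasureTheory

/-- The space of all symmetric bilinear forms on a real vector space `V`. -/
@[ext]
structure SymForm (V : Type*) [AddCommGroup V] [Module ℝ V] where
  toBilin : LinearMap.BilinForm ℝ V
  symm : ∀ v w, toBilin v w = toBilin w v

namespace SymForm

variable {V : Type*} [AddCommGroup V] [Module ℝ V]

/-- The coordinates `(σ(v_i, v_j))_{i ≤ j}` of a symmetric bilinear form `σ` in a basis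
`(v_i)` of `V`. -/
noncomputable def coords {n : ℕ} (b : Module.Basis (Fin n) ℝ V) (σ : SymForm V) :
    {ij : Fin n × Fin n // ij.1 ≤ ij.2} → ℝ :=
  fun ij => σ.toBilin (b ij.1.1) (b ij.1.2)

/-- The topology of the space of symmetric bilinear forms: the pull-back of the topology of
`ℝ^{n(n+1)/2}` by the coordinates in a basis. It does not depend on the basis
(`SymForm.topology_eq_induced_coords`). -/
noncomputable instance instTopologicalSpace [FiniteDimensional ℝ V] :
    TopologicalSpace (SymForm V) :=
  TopologicalSpace.induced (coords (Module.finBasis ℝ V)) inferInstance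

/-- If all coordinates in one basis are continuous for a topology `t`, so is every
evaluation. -/
theorem continuous_eval_of_coords {X : Type*} [TopologicalSpace X] {n : ℕ}
    (b : Module.Basis (Fin n) ℝ V) (f : X → SymForm V)
    (hf : Continuous fun x => coords b (f x)) (v w : V) :
    Continuous fun x => (f x).toBilin v w := by
  have key : ∀ i j, Continuous fun x => (f x).toBilin (b i) (b j) := by
    intro i j
    rcases le_total i j with h | h
    · exact (continuous_apply (⟨(i, j), h⟩ : {ij : Fin n × Fin n // ij.1 ≤ ij.2})).comp hf
    · have := (continuous_apply (⟨(j, i), h⟩ : {ij : Fin n × Fin n // ij.1 ≤ ij.2})).comp hf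
      refine this.congr fun x => ?_
      exact (f x).symm _ _
  have : (fun x => (f x).toBilin v w) =
      fun x => ∑ i, ∑ j, b.repr v i * (b.repr w j * (f x).toBilin (b i) (b j)) := by
    funext x
    conv_lhs => rw [← b.sum_repr v, ← b.sum_repr w]
    simp only [map_sum, map_smul, LinearMap.sum_apply, LinearMap.smul_apply, smul_eq_mul,
      Finset.mul_sum]
    rw [Finset.sum_comm]
    refine Finset.sum_congr rfl fun i _ => Finset.sum_congr rfl fun j _ => ?_
    ring
  rw [this]
  fun_prop (disch := skip)

/-- The topology is the one pulled back by the coordinates in any basis. -/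
theorem topology_eq_induced_coords [FiniteDimensional ℝ V] {n : ℕ}
    (b : Module.Basis (Fin n) ℝ V) :
    (instTopologicalSpace : TopologicalSpace (SymForm V)) =
      TopologicalSpace.induced (coords b) inferInstance := by
  apply le_antisymm
  · rw [← continuous_iff_le_induced]
    refine continuous_pi fun ij => ?_
    exact continuous_eval_of_coords (Module.finBasis ℝ V) id continuous_induced_dom _ _
  · let t : TopologicalSpace (SymForm V) :=
      TopologicalSpace.induced (coords b) inferInstance
    change t ≤ TopologicalSpace.induced (coords (Module.finBasis ℝ V)) inferInstance
    rw [← continuous_iff_le_induced]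
    refine continuous_pi fun ij => ?_
    exact continuous_eval_of_coords b id continuous_induced_dom _ _

/-- `σ` is a scalar product: it is non-degenerate. -/
def IsScalarProduct (σ : SymForm V) : Prop :=
  ∀ v, (∀ w, σ.toBilin v w = 0) → v = 0

/-- A basis `(v_i)` is orthonormal with respect to `σ`: distinct elements of it are orthogonal
and `σ(v_i, v_i) = ±1` for every `i`. -/
def IsOrthonormalBasis (σ : SymForm V) {n : ℕ} (b : Module.Basis (Fin n) ℝ V) : Prop :=
  (∀ i j, i ≠ j → σ.toBilin (b i) (b j) = 0) ∧
    ∀ i, σ.toBilin (b i) (b i) = 1 ∨ σ.toBilin (b i) (b i) = -1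

/-- `σ` has signature `(p, p')`: there is a `σ`-orthonormal basis of `V` with exactly `p`
elements of square `1` and exactly `p'` elements of square `-1`. -/
def HasSignature (σ : SymForm V) (p p' : ℕ) : Prop :=
  ∃ b : Module.Basis (Fin (Module.finrank ℝ V)) ℝ V, σ.IsOrthonormalBasis b ∧
    {i | σ.toBilin (b i) (b i) = 1}.ncard = p ∧
    {i | σ.toBilin (b i) (b i) = -1}.ncard = p'

/-- The form `g^{-1*} σ`, that is, `(v, w) ↦ σ(g⁻¹ v, g⁻¹ w)`. -/
def translate (g : V ≃ₗ[ℝ] V) (σ : SymForm V) : SymForm V where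
  toBilin := σ.toBilin.compl₁₂ (g⁻¹ : V ≃ₗ[ℝ] V).toLinearMap (g⁻¹ : V ≃ₗ[ℝ] V).toLinearMap
  symm _ _ := σ.symm _ _

theorem translate_apply (g : V ≃ₗ[ℝ] V) (σ : SymForm V) (v w : V) :
    (translate g σ).toBilin v w = σ.toBilin (g⁻¹ v) (g⁻¹ w) := rfl

/-- The natural action `g σ = g^{-1*} σ` of `GL(V)` on symmetric bilinear forms. -/
instance instMulAction : MulAction (V ≃ₗ[ℝ] V) (SymForm V) where
  smul := translate
  one_smul σ := by
    ext v w
    change (translate 1 σ).toBilin v w = _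
    rw [translate_apply, inv_one]
    rfl
  mul_smul g h σ := by
    ext v w
    change (translate (g * h) σ).toBilin v w = (translate g (translate h σ)).toBilin v w
    rw [translate_apply, translate_apply, translate_apply, mul_inv_rev]
    rfl

theorem smul_apply (g : V ≃ₗ[ℝ] V) (σ : SymForm V) (v w : V) :
    (g • σ).toBilin v w = σ.toBilin (g⁻¹ v) (g⁻¹ w) := rfl

theorem IsScalarProduct.smul {σ : SymForm V} (h : σ.IsScalarProduct) (g : V ≃ₗ[ℝ] V) :
    (g • σ).IsScalarProduct := by
  intro v hv
  have : (g⁻¹ : V ≃ₗ[ℝ] V) v = 0 := by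
    refine h _ fun w => ?_
    have := hv (g w)
    rwa [smul_apply, ← LinearEquiv.mul_apply, inv_mul_cancel, LinearEquiv.coe_one] at this
  exact (LinearEquiv.map_eq_zero_iff _).1 this

theorem HasSignature.smul {σ : SymForm V} {p p' : ℕ} (h : σ.HasSignature p p')
    (g : V ≃ₗ[ℝ] V) : (g • σ).HasSignature p p' := by
  obtain ⟨b, ⟨h1, h2⟩, h3, h4⟩ := h
  have key : ∀ i j, (g • σ).toBilin (b.map g i) (b.map g j) = σ.toBilin (b i) (b j) := by
    intro i j
    rw [smul_apply, Module.Basis.map_apply, Module.Basis.map_apply, ← LinearEquiv.mul_apply,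
      ← LinearEquiv.mul_apply, inv_mul_cancel]
    rfl
  refine ⟨b.map g, ⟨?_, ?_⟩, ?_, ?_⟩ <;> simpa only [key]

end SymForm

/-- The space `Γ` of all scalar products on `V` of signature `(p, p')`, as a subspace of the
space of all symmetric bilinear forms on `V`. -/
def ScalarProducts (V : Type*) [AddCommGroup V] [Module ℝ V] (p p' : ℕ) : Set (SymForm V) :=
  {σ | σ.IsScalarProduct ∧ σ.HasSignature p p'}

namespace ScalarProducts

variable {V : Type*} [AddCommGroup V] [Module ℝ V] {p p' : ℕ}

/-- The natural action `g γ = g^{-1*} γ` of `GL(V)` on `Γ`. -/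
instance instMulAction : MulAction (V ≃ₗ[ℝ] V) (ScalarProducts V p p') where
  smul g γ := ⟨g • γ.1, γ.2.1.smul g, γ.2.2.smul g⟩
  one_smul γ := Subtype.ext (one_smul _ γ.1)
  mul_smul g h γ := Subtype.ext (mul_smul g h γ.1)

/-- Every `g ∈ GL(V)` acts on `Γ` by a continuous map, hence by a homeomorphism. In
particular it is Borel measurable and the push-forward of measures by it is meaningful. -/
instance instContinuousConstSMul [FiniteDimensional ℝ V] :
    ContinuousConstSMul (V ≃ₗ[ℝ] V) (ScalarProducts V p p') where
  continuous_const_smul g := by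
    refine Continuous.subtype_mk ?_ _
    refine continuous_induced_rng.2 (continuous_pi fun ij => ?_)
    have h : Continuous (SymForm.coords (V := V) (Module.finBasis ℝ V)) :=
      continuous_induced_dom
    exact SymForm.continuous_eval_of_coords (Module.finBasis ℝ V) Subtype.val
      (h.comp continuous_subtype_val) _ _

/-- The Borel σ-algebra of `Γ`. -/
noncomputable instance instMeasurableSpace [FiniteDimensional ℝ V] :
    MeasurableSpace (ScalarProducts V p p') :=
  borel _

instance instBorelSpace [FiniteDimensional ℝ V] : BorelSpace (ScalarProducts V p p') :=
  ⟨rfl⟩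

/-- A Borel measure on `Γ` is invariant if its push-forward by every `g ∈ GL(V)` is the
measure itself. -/
def IsInvariant [FiniteDimensional ℝ V] (μ : Measure (ScalarProducts V p p')) : Prop :=
  ∀ g : V ≃ₗ[ℝ] V, μ.map (fun γ => g • γ) = μ

end ScalarProducts

/-! In a basis, the Gram matrix identifies Γ with an open subset of the space of symmetric `n × n`
matrices, of dimension `d` (`isOpenEmbedding_gram`), and `g` acts by the congruence `A ↦ Pᵀ A P`,
where `P` is the matrix of `g⁻¹`.

Existence: this congruence scales Lebesgue measure by `|det P| ^ (2d/n)` (`congruenceDet_eq`), while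
`|det A|` is scaled by `|det P| ^ 2`. Hence `|det A| ^ (-d/n) dA` is invariant. The factor is found
without eigenvalues or the value of `d`: it is multiplicative in `P`, so its `n`-th power is
determined by scalar matrices (`map_pow_eq_map_det_smul_one`).

Uniqueness: `GL(V)` is transitive on Γ, as orthonormal bases of equal signature can be matched. By
Fubini, invariant measures have the null sets dictated by a right quasi-invariant measure on the
group, so they are mutually absolutely continuous. The Radon–Nikodym derivative of one by the other
is invariant almost everywhere, and a second use of Fubini makes it constant
(`exists_eq_smul_of_invariant`). Lebesgue measure on invertible matrices suffices as the group
measure. -/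

/-! ### Uniqueness of invariant measures on homogeneous spaces -/

section HomogeneousSpace

open scoped ENNReal

variable {G X : Type*} [Group G] [MeasurableSpace G] [MeasurableSpace X] [MulAction G X]
  [MulAction.IsPretransitive G X]

/-- Invariant measures on a homogeneous space have the same null sets: they are the sets whose
preimages under the orbit maps are null sets of the group. -/
theorem measure_eq_zero_iff_orbit_of_invariant (m : Measure G) [SFinite m] (hm : m ≠ 0)
    (hmul : ∀ a : G, Measure.QuasiMeasurePreserving (fun g => g * a) m m)
    (hact : Measurable fun q : G × X => q.1 • q.2)
    (μ : Measure X) [SFinite μ] (hμ : μ ≠ 0)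
    (hinv : ∀ g : G, μ.map (fun x => g • x) = μ)
    {s : Set X} (hs : MeasurableSet s) (x₀ : X) :
    μ s = 0 ↔ m {g | g • x₀ ∈ s} = 0 := by
  have hsm : ∀ g : G, Measurable fun x : X => g • x := fun g =>
    hact.comp measurable_prodMk_left
  have hms : MeasurableSet {q : G × X | q.1 • q.2 ∈ s} := hact hs
  -- Invariance of `μ` makes the inner condition independent of `g`.
  have h1 : (∀ᵐ g ∂m, ∀ᵐ x ∂μ, g • x ∉ s) ↔ μ s = 0 := by
    have : ∀ g : G, (∀ᵐ x ∂μ, g • x ∉ s) ↔ μ s = 0 := by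
      intro g
      conv_rhs => rw [← hinv g, Measure.map_apply (hsm g) hs]
      simp only [ae_iff, not_not]
      rfl
    simp only [this]
    have : NeZero m := ⟨hm⟩
    exact Filter.eventually_const
  -- Moving the base point by `a` right-translates the set of group elements, which preserves
  -- `m`-null sets.
  have h2 : ∀ x : X, m {g | g • x₀ ∈ s} = 0 ↔ ∀ᵐ g ∂m, g • x ∉ s := by
    have key : ∀ x y : X, m {g | g • x ∈ s} = 0 → m {g | g • y ∈ s} = 0 := by
      intro x y h
      obtain ⟨a, rfl⟩ := MulAction.exists_smul_eq G x y
      have := (hmul a).preimage_null h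
      simpa only [Set.preimage_ofPred_eq, mul_smul] using this
    intro x
    simp only [ae_iff, not_not]
    exact ⟨key _ _, key _ _⟩
  have : NeZero μ := ⟨hμ⟩
  rw [← h1, Measure.ae_ae_comm hms.compl]
  simp only [← h2]
  exact Filter.eventually_const

/-- Two invariant `σ`-finite measures on a homogeneous space are proportional. -/
theorem exists_eq_smul_of_invariant (m : Measure G) [SFinite m] (hm : m ≠ 0)
    (hmul : ∀ a : G, Measure.QuasiMeasurePreserving (fun g => g * a) m m)
    (hact : Measurable fun q : G × X => q.1 • q.2)
    (μ ν : Measure X) [SigmaFinite μ] [SigmaFinite ν] (hμ : μ ≠ 0) (hν : ν ≠ 0)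
    (hμinv : ∀ g : G, μ.map (fun x => g • x) = μ)
    (hνinv : ∀ g : G, ν.map (fun x => g • x) = ν) :
    ∃ c : NNReal, 0 < c ∧ ν = c • μ := by
  have hsm : ∀ g : G, Measurable fun x : X => g • x := fun g =>
    hact.comp measurable_prodMk_left
  have : NeZero μ := ⟨hμ⟩
  have hac : ν ≪ μ := by
    refine Measure.AbsolutelyContinuous.mk fun s hs h => ?_
    obtain ⟨x₀, -⟩ := (Filter.Eventually.of_forall (f := ae μ) fun _ => trivial).exists
    rw [measure_eq_zero_iff_orbit_of_invariant m hm hmul hact μ hμ hμinv hs x₀] at h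
    rwa [measure_eq_zero_iff_orbit_of_invariant m hm hmul hact ν hν hνinv hs x₀]
  set ρ : X → ℝ≥0∞ := ν.rnDeriv μ with hρdef
  have hρ : Measurable ρ := Measure.measurable_rnDeriv ν μ
  have hνρ : μ.withDensity ρ = ν := Measure.withDensity_rnDeriv_eq ν μ hac
  -- By invariance of both measures, `ρ` and its translate are densities of `ν` with respect to `μ`,
  -- hence agree almost everywhere.
  have hρinv : ∀ g : G, ∀ᵐ x ∂μ, ρ (g • x) = ρ x := by
    intro g
    refine (withDensity_eq_iff_of_sigmaFinite (hρ.comp (hsm g)).aemeasurable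
      hρ.aemeasurable).1 ?_
    rw [hνρ]
    ext s hs
    have hT : MeasurableSet ((fun x : X => g⁻¹ • x) ⁻¹' s) := hsm g⁻¹ hs
    have hsT : s = (fun x : X => g • x) ⁻¹' ((fun x : X => g⁻¹ • x) ⁻¹' s) := by
      ext x; simp
    rw [withDensity_apply _ hs]
    conv_lhs => rw [hsT]
    simp only [Function.comp_def]
    rw [← setLIntegral_map hT hρ (hsm g), hμinv g, ← withDensity_apply _ hT, hνρ,
      ← Measure.map_apply (hsm g⁻¹) hs, hνinv]
  have hms : MeasurableSet {q : G × X | ρ (q.1 • q.2) = ρ q.2} :=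
    measurableSet_eq_fun (hρ.comp hact) (hρ.comp measurable_snd)
  -- The exceptional set of `x` depends on `g`. Fubini exchanges the quantifiers and gives one `x₀`
  -- that works for almost all `g`; the null-set criterion then applies to the complement of the
  -- level set of `ρ x₀`.
  have hae : ∀ᵐ x ∂μ, ∀ᵐ g ∂m, ρ (g • x) = ρ x :=
    (Measure.ae_ae_comm hms).1 (Filter.Eventually.of_forall hρinv)
  obtain ⟨x₀, hx₀, hfin⟩ := (hae.and (Measure.rnDeriv_lt_top ν μ)).exists
  have hconst : ∀ᵐ x ∂μ, ρ x = ρ x₀ :=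
    (measure_eq_zero_iff_orbit_of_invariant m hm hmul hact μ hμ hμinv
      (hρ (measurableSet_singleton (ρ x₀))).compl x₀).2 hx₀
  have hνc : ν = ρ x₀ • μ := by
    rw [← withDensity_const, ← hνρ]
    exact withDensity_congr_ae hconst
  refine ⟨(ρ x₀).toNNReal, ?_, ?_⟩
  · refine pos_iff_ne_zero.2 fun h => hν ?_
    have : ρ x₀ = 0 := by
      rcases (ENNReal.toNNReal_eq_zero_iff _).1 h with h | h
      · exact h
      · exact absurd h hfin.ne
    rw [hνc, this, zero_smul]
  · change ν = ((ρ x₀).toNNReal : ℝ≥0∞) • μ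
    rw [ENNReal.coe_toNNReal hfin.ne]
    exact hνc

end HomogeneousSpace

/-! ### Symmetric matrices and the determinant of a congruence -/

section SymmetricMatrices

open Matrix

variable {n : ℕ}

/-- The space of real symmetric `n × n` matrices, as a subspace of the product space of all
families `(A i j)`. -/
def symMatrices (n : ℕ) : Submodule ℝ (Fin n → Fin n → ℝ) where
  carrier := {A | ∀ i j, A i j = A j i}
  add_mem' ha hb i j := by
    simp only [Pi.add_apply, ha i j, hb i j]
  zero_mem' _ _ := rfl
  smul_mem' c a ha i j := by
    simp only [Pi.smul_apply, ha i j]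

namespace symMatrices

/-- A symmetric family as a matrix. -/
def toMat (A : symMatrices n) : Matrix (Fin n) (Fin n) ℝ := Matrix.of A.1

theorem toMat_injective : Function.Injective (toMat (n := n)) :=
  fun _ _ h => Subtype.ext (Matrix.of.injective h)

theorem transpose_toMat (A : symMatrices n) : (toMat A)ᵀ = toMat A :=
  Matrix.ext fun i j => A.2 j i

/-- The symmetric family of a symmetric matrix. -/
def ofMat (M : Matrix (Fin n) (Fin n) ℝ) (h : Mᵀ = M) : symMatrices n :=
  ⟨fun i j => M i j, fun i j => congrFun (congrFun h j) i⟩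

theorem toMat_ofMat (M : Matrix (Fin n) (Fin n) ℝ) (h : Mᵀ = M) : toMat (ofMat M h) = M := rfl

theorem toMat_add (A B : symMatrices n) : toMat (A + B) = toMat A + toMat B := rfl

theorem toMat_smul (c : ℝ) (A : symMatrices n) : toMat (c • A) = c • toMat A := rfl

theorem continuous_toMat : Continuous (toMat (n := n)) := continuous_subtype_val

theorem continuous_det : Continuous fun A : symMatrices n => (toMat A).det :=
  continuous_toMat.matrix_det

/-- The congruence `A ↦ Pᵀ A P` of symmetric matrices. -/
def congruence (P : Matrix (Fin n) (Fin n) ℝ) : symMatrices n →ₗ[ℝ] symMatrices n where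
  toFun A := ofMat (Pᵀ * toMat A * P) (by
    rw [transpose_mul, transpose_mul, transpose_transpose, transpose_toMat, Matrix.mul_assoc])
  map_add' A B := toMat_injective (by
    simp only [toMat_ofMat, toMat_add, Matrix.mul_add, Matrix.add_mul])
  map_smul' c A := toMat_injective (by
    simp only [toMat_ofMat, toMat_smul, Matrix.mul_smul, Matrix.smul_mul, RingHom.id_apply])

theorem toMat_congruence (P : Matrix (Fin n) (Fin n) ℝ) (A : symMatrices n) :
    toMat (congruence P A) = Pᵀ * toMat A * P := rfl

theorem congruence_one : congruence (1 : Matrix (Fin n) (Fin n) ℝ) = LinearMap.id :=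
  LinearMap.ext fun A => toMat_injective (by
    simp only [toMat_congruence, transpose_one, Matrix.one_mul, Matrix.mul_one, LinearMap.id_apply])

theorem congruence_mul (P Q : Matrix (Fin n) (Fin n) ℝ) :
    congruence (P * Q) = (congruence Q) ∘ₗ (congruence P) :=
  LinearMap.ext fun A => toMat_injective (by
    simp only [toMat_congruence, transpose_mul, Matrix.mul_assoc, LinearMap.comp_apply])

/-- The multiplicative function `P ↦ |det (A ↦ Pᵀ A P)|`. -/
noncomputable def congruenceDet : Matrix (Fin n) (Fin n) ℝ →* ℝ where
  toFun P := |LinearMap.det (congruence P)|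
  map_one' := by rw [congruence_one, LinearMap.det_id, abs_one]
  map_mul' P Q := by rw [congruence_mul, LinearMap.det_comp, abs_mul, mul_comm]

theorem congruenceDet_apply (P : Matrix (Fin n) (Fin n) ℝ) :
    congruenceDet P = |LinearMap.det (congruence P)| := rfl

theorem congruenceDet_scalar (c : ℝ) :
    congruenceDet (c • (1 : Matrix (Fin n) (Fin n) ℝ)) =
      |c| ^ (2 * Module.finrank ℝ (symMatrices n)) := by
  have : congruence (c • (1 : Matrix (Fin n) (Fin n) ℝ)) = (c ^ 2) • LinearMap.id :=
    LinearMap.ext fun A => toMat_injective (by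
      rw [LinearMap.smul_apply, LinearMap.id_apply, toMat_congruence, toMat_smul, transpose_smul,
        transpose_one, Matrix.smul_mul, Matrix.one_mul, Matrix.mul_smul, Matrix.mul_one, sq,
        smul_smul])
  rw [congruenceDet_apply, this, LinearMap.det_smul, LinearMap.det_id, mul_one, abs_pow, abs_pow,
    pow_mul]

end symMatrices

/-! ### Multiplicative functions on matrices -/

/-- A real multiplicative function on matrices takes the same value on two similar matrices. -/
theorem map_eq_of_mul_eq_mul (χ : Matrix (Fin n) (Fin n) ℝ →* ℝ)
    {U P Q : Matrix (Fin n) (Fin n) ℝ} (hU : IsUnit U) (h : U * P = Q * U) : χ P = χ Q := by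
  have hχ : χ U ≠ 0 := (hU.map χ).ne_zero
  have := congrArg χ h
  rw [map_mul, map_mul, mul_comm (χ Q)] at this
  exact mul_left_cancel₀ hχ this

/-- Scaling the `i`-th coordinate by 2 conjugates the transvection of parameter `c` to that of
parameter `2c`, which is its square; so its value under `χ` is nonzero and equal to its own square.
-/
theorem map_transvection_eq_one (χ : Matrix (Fin n) (Fin n) ℝ →* ℝ) {i j : Fin n} (hij : i ≠ j)
    (c : ℝ) : χ (transvection i j c) = 1 := by
  have hdet : (transvection i j c).det = 1 := det_transvection_of_ne i j hij c
  have h0 : χ (transvection i j c) ≠ 0 := by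
    have : IsUnit (transvection i j c) := by
      rw [isUnit_iff_isUnit_det, hdet]; exact isUnit_one
    exact (this.map χ).ne_zero
  have hD : IsUnit (diagonal (Pi.single i 1 + 1 : Fin n → ℝ)) := by
    rw [isUnit_iff_isUnit_det, det_diagonal, isUnit_iff_ne_zero, Finset.prod_ne_zero_iff]
    intro k _
    by_cases h : k = i
    · subst h; norm_num
    · simp [h]
  have hsim : diagonal (Pi.single i 1 + 1 : Fin n → ℝ) * transvection i j c =
      transvection i j (c + c) * diagonal (Pi.single i 1 + 1 : Fin n → ℝ) := by
    ext k l
    rw [diagonal_mul, mul_diagonal]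
    simp only [transvection, Matrix.add_apply, Matrix.one_apply, single_apply, Pi.add_apply,
      Pi.single_apply, Pi.one_apply]
    grind
  have := map_eq_of_mul_eq_mul χ hD hsim
  rw [← transvection_mul_transvection_same i j hij, map_mul] at this
  exact mul_left_cancel₀ h0 (by rw [mul_one]; exact this.symm)

theorem map_diagonal_comp_perm (χ : Matrix (Fin n) (Fin n) ℝ →* ℝ) (σ : Equiv.Perm (Fin n))
    (d : Fin n → ℝ) : χ (diagonal (d ∘ σ)) = χ (diagonal d) := by
  have hU : IsUnit (σ.permMatrix ℝ) := by
    rw [isUnit_iff_isUnit_det, det_permutation]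
    exact (Int.isUnit_iff.2 (Int.units_eq_one_or (Equiv.Perm.sign σ) |>.imp
      (fun h => by rw [h]; rfl) fun h => by rw [h]; rfl)).map (Int.castRingHom ℝ)
  refine (map_eq_of_mul_eq_mul χ hU ?_).symm
  ext i j
  rw [mul_diagonal, diagonal_mul]
  simp only [Equiv.Perm.permMatrix, PEquiv.toMatrix_apply, Equiv.toPEquiv_apply,
    Option.mem_some_iff, Function.comp]
  split_ifs with h
  · rw [h, mul_comm]
  · simp

/-- The `n` cyclic shifts of `d` give similar diagonal matrices, whose product is the scalar matrix
with entry `∏ i, d i`. -/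
theorem map_diagonal_pow [NeZero n] (χ : Matrix (Fin n) (Fin n) ℝ →* ℝ) (d : Fin n → ℝ) :
    χ (diagonal d) ^ n = χ ((diagonal d).det • (1 : Matrix (Fin n) (Fin n) ℝ)) := by
  have h : ∏ k : Fin n, (d ∘ Equiv.addRight k) = fun _ => ∏ i, d i := by
    funext i
    rw [Finset.prod_apply]
    exact Fintype.prod_equiv (Equiv.addLeft i) _ _ fun k => rfl
  have hmap := map_prod (χ.comp (diagonalRingHom (Fin n) ℝ).toMonoidHom)
    (fun k : Fin n => d ∘ Equiv.addRight k) Finset.univ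
  rw [h] at hmap
  have : ∀ k : Fin n, (χ.comp (diagonalRingHom (Fin n) ℝ).toMonoidHom) (d ∘ Equiv.addRight k) =
      χ (diagonal d) := fun k => map_diagonal_comp_perm χ _ d
  simp only [this, Finset.prod_const, Finset.card_univ, Fintype.card_fin] at hmap
  rw [← hmap, det_diagonal, smul_one_eq_diagonal]
  rfl

/-- The `n`-th power of a real multiplicative function on invertible `n × n` matrices is determined
by its values on scalar matrices. -/
theorem map_pow_eq_map_det_smul_one [NeZero n] (χ : Matrix (Fin n) (Fin n) ℝ →* ℝ)
    (P : Matrix (Fin n) (Fin n) ℝ) (hP : P.det ≠ 0) :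
    χ P ^ n = χ (P.det • (1 : Matrix (Fin n) (Fin n) ℝ)) := by
  refine diagonal_transvection_induction_of_det_ne_zero
    (fun P => χ P ^ n = χ (P.det • (1 : Matrix (Fin n) (Fin n) ℝ))) P hP
    (fun d _ => map_diagonal_pow χ d) (fun t => ?_) (fun A B _ _ hA hB => ?_)
  · rw [TransvectionStruct.det, one_smul, map_one]
    have : χ t.toMatrix = 1 := map_transvection_eq_one χ t.hij t.c
    rw [this, one_pow]
  · rw [map_mul, mul_pow, hA, hB, det_mul, ← map_mul, smul_mul_smul_comm, Matrix.one_mul]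

namespace symMatrices

/-- The exponent `d / n`, where `d` is the dimension of the space of symmetric matrices. -/
noncomputable def densityExponent (n : ℕ) : ℝ := Module.finrank ℝ (symMatrices n) / n

/-- Both sides are nonnegative, so their `n`-th powers may be compared; the scalar matrix of entry
`det P` acts by multiplication by `(det P) ^ 2`. -/
theorem congruenceDet_eq [NeZero n] (P : Matrix (Fin n) (Fin n) ℝ) (hP : P.det ≠ 0) :
    congruenceDet P = (|P.det| ^ 2) ^ densityExponent n := by
  have hn : (n : ℝ) ≠ 0 := Nat.cast_ne_zero.2 (NeZero.ne n)
  refine (pow_left_inj₀ (abs_nonneg _) (by positivity) (NeZero.ne n)).1 ?_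
  have h1 := map_pow_eq_map_det_smul_one congruenceDet P hP
  rw [congruenceDet_scalar] at h1
  rw [h1, ← Real.rpow_mul_natCast (by positivity), densityExponent, div_mul_cancel₀ _ hn,
    Real.rpow_natCast, pow_mul]

end symMatrices

end SymmetricMatrices

/-! ### Gram matrices -/

namespace SymForm

open Matrix

variable {V : Type*} [AddCommGroup V] [Module ℝ V] {n : ℕ}

/-- The Gram matrix `(σ(v_i, v_j))` of a symmetric bilinear form in a basis `(v_i)`. -/
noncomputable def gram (b : Module.Basis (Fin n) ℝ V) (σ : SymForm V) : symMatrices n :=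
  ⟨fun i j => σ.toBilin (b i) (b j), fun _ _ => σ.symm _ _⟩

theorem toMat_gram (b : Module.Basis (Fin n) ℝ V) (σ : SymForm V) :
    (symMatrices.toMat (gram b σ)) = LinearMap.BilinForm.toMatrix b σ.toBilin := by
  ext i j
  rw [LinearMap.BilinForm.toMatrix_apply]
  rfl

theorem gram_injective (b : Module.Basis (Fin n) ℝ V) : Function.Injective (gram b) :=
  fun _ _ h => SymForm.ext (LinearMap.BilinForm.ext_basis b fun i j =>
    congrFun (congrFun (congrArg Subtype.val h) i) j)

theorem gram_smul (b : Module.Basis (Fin n) ℝ V) (g : V ≃ₗ[ℝ] V) (σ : SymForm V) :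
    gram b (g • σ) = symMatrices.congruence
      (LinearMap.toMatrix b b (g⁻¹ : V ≃ₗ[ℝ] V).toLinearMap) (gram b σ) := by
  apply symMatrices.toMat_injective
  rw [symMatrices.toMat_congruence, toMat_gram, toMat_gram]
  exact LinearMap.BilinForm.toMatrix_comp b b σ.toBilin _ _

theorem IsScalarProduct.det_gram_ne_zero {σ : SymForm V} (h : σ.IsScalarProduct)
    (b : Module.Basis (Fin n) ℝ V) : (symMatrices.toMat (gram b σ)).det ≠ 0 := by
  rw [toMat_gram]
  refine (LinearMap.BilinForm.nondegenerate_iff_det_ne_zero b).1 ⟨h, fun v hv => h v fun w => ?_⟩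
  rw [σ.symm]
  exact hv w

theorem isInducing_gram [FiniteDimensional ℝ V] (b : Module.Basis (Fin n) ℝ V) :
    Topology.IsInducing (gram b) := by
  have hc : Topology.IsInducing (coords b) := ⟨topology_eq_induced_coords b⟩
  have hg : Continuous (gram b) := by
    refine Continuous.subtype_mk (continuous_pi fun i => continuous_pi fun j => ?_) _
    exact continuous_eval_of_coords b id hc.continuous _ _
  let r : symMatrices n → {ij : Fin n × Fin n // ij.1 ≤ ij.2} → ℝ := fun A ij => A.1 ij.1.1 ij.1.2
  have hr : Continuous r := by
    refine continuous_pi fun ij => ?_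
    exact (continuous_apply ij.1.2).comp ((continuous_apply ij.1.1).comp continuous_subtype_val)
  -- The upper-triangular coordinates factor through the Gram matrix by the continuous map `r`.
  exact Topology.IsInducing.of_comp hg hr hc

end SymForm

/-! ### Openness of congruence orbits -/

namespace symMatrices

open Matrix Topology

variable {n : ℕ}

/-- The symmetrized product `(S, T) ↦ (S M T + T M S) / 2`, for a symmetric matrix `M`. -/
noncomputable def jordanProduct (M : Matrix (Fin n) (Fin n) ℝ) (hM : Mᵀ = M) :
    symMatrices n →ₗ[ℝ] symMatrices n →ₗ[ℝ] symMatrices n :=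
  LinearMap.mk₂ ℝ
    (fun S T => ofMat ((1 / 2 : ℝ) • (toMat S * M * toMat T + toMat T * M * toMat S)) (by
      simp only [transpose_smul, transpose_add, transpose_mul, transpose_toMat, hM,
        Matrix.mul_assoc]
      rw [add_comm]))
    (fun S S' T => toMat_injective (by
      simp only [toMat_ofMat, toMat_add, Matrix.mul_add, Matrix.add_mul, ← smul_add]
      congr 1; abel))
    (fun c S T => toMat_injective (by
      simp only [toMat_ofMat, toMat_smul, Matrix.mul_smul, Matrix.smul_mul, ← smul_add]
      rw [smul_comm]))
    (fun S T T' => toMat_injective (by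
      simp only [toMat_ofMat, toMat_add, Matrix.mul_add, Matrix.add_mul, ← smul_add]
      congr 1; abel))
    (fun c S T => toMat_injective (by
      simp only [toMat_ofMat, toMat_smul, Matrix.mul_smul, Matrix.smul_mul, ← smul_add]
      rw [smul_comm]))

theorem toMat_jordanProduct (M : Matrix (Fin n) (Fin n) ℝ) (hM : Mᵀ = M) (S T : symMatrices n) :
    toMat (jordanProduct M hM S T) =
      (1 / 2 : ℝ) • (toMat S * M * toMat T + toMat T * M * toMat S) := rfl

/-- The orbit of an invertible symmetric matrix under congruence is a neighbourhood of it: every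
symmetric matrix close to `A` has the form `S A⁻¹ S` with `S` symmetric and close to `A`. -/
theorem exists_congruence_mem_nhds (A : symMatrices n) (hA : (toMat A).det ≠ 0) :
    {B | ∃ P : Matrix (Fin n) (Fin n) ℝ, P.det ≠ 0 ∧ congruence P A = B} ∈ 𝓝 A := by
  have hAu : IsUnit (toMat A).det := isUnit_iff_ne_zero.2 hA
  have hM : ((toMat A)⁻¹)ᵀ = (toMat A)⁻¹ := by rw [transpose_nonsing_inv, transpose_toMat]
  let J := (jordanProduct _ hM).toContinuousBilinearMap
  have hJ : ∀ S : symMatrices n, toMat (J S S) = toMat S * (toMat A)⁻¹ * toMat S := by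
    intro S
    change toMat (jordanProduct _ hM S S) = _
    rw [toMat_jordanProduct, ← two_smul ℝ, smul_smul]
    norm_num
  have hJA : ∀ S : symMatrices n, J A S = S ∧ J S A = S := by
    intro S
    constructor <;> apply toMat_injective
    · change toMat (jordanProduct _ hM A S) = _
      rw [toMat_jordanProduct, mul_nonsing_inv _ hAu, nonsing_inv_mul_cancel_right _ _ hAu,
        Matrix.one_mul, ← two_smul ℝ, smul_smul]
      norm_num
    · change toMat (jordanProduct _ hM S A) = _
      rw [toMat_jordanProduct, mul_nonsing_inv _ hAu, nonsing_inv_mul_cancel_right _ _ hAu,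
        Matrix.one_mul, ← two_smul ℝ, smul_smul]
      norm_num
  have hder := J.hasStrictFDerivAt_of_bilinear (hasStrictFDerivAt_id (𝕜 := ℝ) A)
    (hasStrictFDerivAt_id (𝕜 := ℝ) A)
  -- The derivative of `S ↦ S A⁻¹ S` at `A` is `T ↦ 2T`, so this map sends neighbourhoods of `A` to
  -- neighbourhoods of its value there, which is `A`.
  have hmap := hder.map_nhds_eq_of_surj (by
    refine LinearMap.range_eq_top.2 fun S => ⟨(1 / 2 : ℝ) • S, ?_⟩
    change J A ((1 / 2 : ℝ) • S) + J ((1 / 2 : ℝ) • S) A = S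
    rw [(hJA _).1, (hJA _).2, ← two_smul ℝ, smul_smul]
    norm_num)
  have hdet : {S : symMatrices n | (toMat S).det ≠ 0} ∈ 𝓝 A :=
    continuous_det.continuousAt.eventually_ne hA
  have himage := Filter.image_mem_map (m := fun S : symMatrices n => J (id S) (id S)) hdet
  rw [hmap] at himage
  simp only [id, (hJA A).1] at himage
  refine Filter.mem_of_superset himage ?_
  rintro _ ⟨S, hS, rfl⟩
  -- By symmetry of `A` and `S`, `S A⁻¹ S = (A⁻¹ S)ᵀ A (A⁻¹ S)`.
  refine ⟨(toMat A)⁻¹ * toMat S, ?_, toMat_injective ?_⟩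
  · rw [det_mul, det_nonsing_inv, Ring.inverse_eq_inv']
    exact mul_ne_zero (inv_ne_zero hA) hS
  · rw [toMat_congruence, hJ, transpose_mul, hM, transpose_toMat,
      nonsing_inv_mul_cancel_right _ _ hAu, Matrix.mul_assoc]

end symMatrices

/-! ### Γ as an open set of matrices and as a homogeneous space -/

namespace ScalarProducts

open Matrix

variable {V : Type*} [AddCommGroup V] [Module ℝ V] {p p' n : ℕ}

theorem exists_linearEquiv_toMatrix_inv (b : Module.Basis (Fin n) ℝ V)
    (P : Matrix (Fin n) (Fin n) ℝ) (hP : P.det ≠ 0) :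
    ∃ g : V ≃ₗ[ℝ] V, LinearMap.toMatrix b b (g⁻¹ : V ≃ₗ[ℝ] V).toLinearMap = P := by
  have h : IsUnit (LinearMap.toMatrix b b (Matrix.toLin b b P)).det := by
    rw [LinearMap.toMatrix_toLin]
    exact isUnit_iff_ne_zero.2 hP
  refine ⟨(LinearEquiv.ofIsUnitDet h)⁻¹, ?_⟩
  rw [inv_inv]
  exact LinearMap.toMatrix_toLin b b P

/-- The Gram matrix of a scalar product of signature `(p, p')` in a basis. -/
noncomputable def gram (b : Module.Basis (Fin n) ℝ V) (γ : ScalarProducts V p p') : symMatrices n :=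
  SymForm.gram b γ.1

theorem det_gram_ne_zero (b : Module.Basis (Fin n) ℝ V) (γ : ScalarProducts V p p') :
    (symMatrices.toMat (gram b γ)).det ≠ 0 :=
  γ.2.1.det_gram_ne_zero b

theorem gram_smul (b : Module.Basis (Fin n) ℝ V) (g : V ≃ₗ[ℝ] V) (γ : ScalarProducts V p p') :
    gram b (g • γ) = symMatrices.congruence
      (LinearMap.toMatrix b b (g⁻¹ : V ≃ₗ[ℝ] V).toLinearMap) (gram b γ) :=
  SymForm.gram_smul b g γ.1

/-- The image is stable under invertible congruences, since these come from `GL(V)`, and their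
orbits are neighbourhoods of each of their points. -/
theorem isOpenEmbedding_gram [FiniteDimensional ℝ V] (b : Module.Basis (Fin n) ℝ V) :
    Topology.IsOpenEmbedding (gram b : ScalarProducts V p p' → symMatrices n) where
  toIsEmbedding := ⟨(SymForm.isInducing_gram b).comp Topology.IsInducing.subtypeVal,
    (SymForm.gram_injective b).comp Subtype.val_injective⟩
  isOpen_range := by
    rw [isOpen_iff_mem_nhds]
    rintro _ ⟨γ, rfl⟩
    refine Filter.mem_of_superset
      (symMatrices.exists_congruence_mem_nhds (gram b γ) (det_gram_ne_zero b γ)) ?_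
    rintro _ ⟨P, hP, rfl⟩
    obtain ⟨g, rfl⟩ := exists_linearEquiv_toMatrix_inv b P hP
    exact ⟨g • γ, gram_smul b g γ⟩

instance isPretransitive : MulAction.IsPretransitive (V ≃ₗ[ℝ] V) (ScalarProducts V p p') where
  exists_smul_eq := by
    rintro ⟨σ, hσ, b, ⟨hb, hb'⟩, hbp, -⟩ ⟨τ, hτ, c, ⟨hc, hc'⟩, hcp, -⟩
    classical
    have hcard : Nat.card {i | σ.toBilin (b i) (b i) = 1} =
        Nat.card {i | τ.toBilin (c i) (c i) = 1} := by
      rw [Nat.card_coe_set_eq, Nat.card_coe_set_eq, hbp, hcp]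
    obtain ⟨e₀⟩ : Nonempty ({i // σ.toBilin (b i) (b i) = 1} ≃ {i // τ.toBilin (c i) (c i) = 1}) :=
      Finite.card_eq.1 hcard
    -- A bijection between the vectors of square 1 extends to all indices; the remaining vectors
    -- have square -1 on both sides.
    let e := e₀.extendSubtype
    have hdiag : ∀ i, σ.toBilin (b i) (b i) = τ.toBilin (c (e i)) (c (e i)) := by
      intro i
      by_cases h : σ.toBilin (b i) (b i) = 1
      · rw [h, e₀.extendSubtype_mem i h]
      · rw [(hb' i).resolve_left h, (hc' (e i)).resolve_left (e₀.extendSubtype_not_mem i h)]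
    refine ⟨b.equiv c e, Subtype.ext (SymForm.ext ?_)⟩
    change ((b.equiv c e) • σ).toBilin = τ.toBilin
    have hinv : ∀ i, ((b.equiv c e)⁻¹ : V ≃ₗ[ℝ] V) (c (e i)) = b i := by
      intro i
      rw [← b.equiv_apply i c e]
      exact (b.equiv c e).symm_apply_apply (b i)
    refine LinearMap.BilinForm.ext_basis (c.reindex e.symm) fun i j => ?_
    simp only [Module.Basis.reindex_apply, Equiv.symm_symm]
    rw [SymForm.smul_apply, hinv, hinv]
    by_cases h : i = j
    · rw [h, hdiag]
    · rw [hb i j h, hc _ _ (e.injective.ne h)]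

theorem nonempty [FiniteDimensional ℝ V] (hp : p + p' = Module.finrank ℝ V) :
    Nonempty (ScalarProducts V p p') := by
  let b := Module.finBasis ℝ V
  let ε : Fin (Module.finrank ℝ V) → ℝ := fun i => if i.1 < p then 1 else -1
  let σ : SymForm V :=
    { toBilin := Matrix.toBilin b (diagonal ε)
      symm := fun v w => by
        rw [Matrix.toBilin_apply, Matrix.toBilin_apply, Finset.sum_comm]
        refine Finset.sum_congr rfl fun i _ => Finset.sum_congr rfl fun j _ => ?_
        by_cases h : i = j
        · subst h; ring
        · rw [diagonal_apply_ne _ h, diagonal_apply_ne _ (Ne.symm h)]; ring }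
  have hσ : ∀ i j, σ.toBilin (b i) (b j) = diagonal ε i j := by
    intro i j
    rw [← LinearMap.BilinForm.toMatrix_apply]
    exact congrFun (congrFun (LinearMap.BilinForm.toMatrix_toBilin b (diagonal ε)) i) j
  have hε : ∀ i, ε i ≠ 0 := by
    intro i
    simp only [ε]
    split_ifs <;> norm_num
  refine ⟨σ, ?_, b, ⟨fun i j h => ?_, fun i => ?_⟩, ?_, ?_⟩
  · have : LinearMap.BilinForm.Nondegenerate σ.toBilin := by
      rw [LinearMap.BilinForm.nondegenerate_iff_det_ne_zero b]
      simp only [σ, LinearMap.BilinForm.toMatrix_toBilin, det_diagonal]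
      exact Finset.prod_ne_zero_iff.2 fun i _ => hε i
    exact this.1
  · rw [hσ, diagonal_apply_ne _ h]
  · rw [hσ, diagonal_apply_eq]
    simp only [ε]
    split_ifs
    · exact Or.inl rfl
    · exact Or.inr rfl
  · have : {i | σ.toBilin (b i) (b i) = 1} = Set.range (Fin.castLE (Nat.le.intro hp)) := by
      ext i
      simp only [hσ, diagonal_apply_eq, ε, Set.mem_ofPred_eq, Fin.range_castLE]
      split_ifs with h <;> (simp [h]; try norm_num)
    rw [this, Set.ncard_eq_toFinset_card', Set.toFinset_range,
      Finset.card_image_of_injective _ (Fin.castLE_injective _), Finset.card_univ, Fintype.card_fin]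
  · have : {i | σ.toBilin (b i) (b i) = -1} =
        (Set.range (Fin.castLE (m := Module.finrank ℝ V) (n := p) (Nat.le.intro hp)))ᶜ := by
      ext i
      simp only [hσ, diagonal_apply_eq, ε, Set.mem_ofPred_eq, Fin.range_castLE, Set.mem_compl_iff]
      split_ifs with h <;> (simp [h]; try norm_num)
    rw [this, Set.ncard_compl, Set.ncard_eq_toFinset_card', Set.toFinset_range,
      Finset.card_image_of_injective _ (Fin.castLE_injective _), Finset.card_univ, Fintype.card_fin,
      Nat.card_fin]
    omega

end ScalarProducts

theorem symMatrices.continuous_congruence {n : ℕ} :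
    Continuous fun q : (Fin n → Fin n → ℝ) × symMatrices n => congruence (Matrix.of q.1) q.2 := by
  refine Continuous.subtype_mk ?_ _
  have h1 : Continuous fun q : (Fin n → Fin n → ℝ) × symMatrices n => Matrix.of q.1 :=
    continuous_fst
  exact (h1.matrix_transpose.matrix_mul (continuous_toMat.comp continuous_snd)).matrix_mul h1

theorem symMatrices.measurable_congruence {n : ℕ} {X : Type*} [MeasurableSpace X]
    {f : X → Fin n → Fin n → ℝ} {h : X → symMatrices n} (hf : Measurable f) (hh : Measurable h) :
    Measurable fun x => congruence (Matrix.of (f x)) (h x) := by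
  have heq : (fun x => congruence (Matrix.of (f x)) (h x)) =
      (fun q : (Fin n → Fin n → ℝ) × symMatrices n => congruence (Matrix.of q.1) q.2) ∘
        fun x => (f x, h x) := by
    funext x
    rw [Function.comp_apply]
  have hm := (continuous_congruence (n := n)).measurable
  rw [heq]
  exact hm.comp (hf.prodMk hh)

/-! ### Uniqueness on Γ -/

namespace ScalarProducts

open Matrix symMatrices

variable {V : Type*} [AddCommGroup V] [Module ℝ V] {p p' n : ℕ}

/-- The matrix of `g⁻¹` in a basis, as a family of reals. -/
noncomputable def invMatrix (b : Module.Basis (Fin n) ℝ V) (g : V ≃ₗ[ℝ] V) :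
    Fin n → Fin n → ℝ :=
  LinearMap.toMatrix b b (g⁻¹ : V ≃ₗ[ℝ] V).toLinearMap

theorem invMatrix_mul (b : Module.Basis (Fin n) ℝ V) (g h : V ≃ₗ[ℝ] V) :
    Matrix.of (invMatrix b (g * h)) = Matrix.of (invMatrix b h) * Matrix.of (invMatrix b g) := by
  change LinearMap.toMatrix b b _ = LinearMap.toMatrix b b _ * LinearMap.toMatrix b b _
  rw [← LinearMap.toMatrix_mul, _root_.mul_inv_rev]
  rfl

theorem det_invMatrix_ne_zero (b : Module.Basis (Fin n) ℝ V) (g : V ≃ₗ[ℝ] V) :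
    (Matrix.of (invMatrix b g)).det ≠ 0 :=
  (LinearEquiv.isUnit_det (g⁻¹ : V ≃ₗ[ℝ] V) b b).ne_zero

theorem invMatrix_injective (b : Module.Basis (Fin n) ℝ V) :
    Function.Injective (invMatrix b) := by
  intro g h hgh
  have : (g⁻¹ : V ≃ₗ[ℝ] V) = h⁻¹ :=
    LinearEquiv.toLinearMap_injective ((LinearMap.toMatrix b b).injective hgh)
  exact inv_injective this

theorem range_invMatrix (b : Module.Basis (Fin n) ℝ V) :
    Set.range (invMatrix b) = {A | (Matrix.of A).det ≠ 0} := by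
  ext A
  constructor
  · rintro ⟨g, rfl⟩
    exact det_invMatrix_ne_zero b g
  · exact fun hA => exists_linearEquiv_toMatrix_inv b (Matrix.of A) hA

theorem isOpen_det_of_ne_zero :
    IsOpen {A : Fin n → Fin n → ℝ | (Matrix.of A).det ≠ 0} := by
  have : Continuous fun A : Fin n → Fin n → ℝ => (Matrix.of A).det :=
    (continuous_id (X := Matrix (Fin n) (Fin n) ℝ)).matrix_det
  exact isOpen_ne_fun this continuous_const

/-- Two invariant regular measures on the space of scalar products are proportional. -/
theorem exists_eq_smul_of_isInvariant [FiniteDimensional ℝ V] (μ ν : Measure (ScalarProducts V p p'))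
    (hμr : μ.Regular) (hμ : IsInvariant μ) (hμ0 : μ ≠ 0)
    (hνr : ν.Regular) (hν : IsInvariant ν) (hν0 : ν ≠ 0) :
    ∃ c : NNReal, 0 < c ∧ ν = c • μ := by
  let b := Module.finBasis ℝ V
  have he := isOpenEmbedding_gram (p := p) (p' := p') b
  have : LocallyCompactSpace (ScalarProducts V p p') := he.locallyCompactSpace
  have : SecondCountableTopology (ScalarProducts V p p') :=
    he.isInducing.secondCountableTopology
  have : IsFiniteMeasureOnCompacts μ := hμr.toIsFiniteMeasureOnCompacts
  have : IsFiniteMeasureOnCompacts ν := hνr.toIsFiniteMeasureOnCompacts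
  have hsμ : SigmaFinite μ := inferInstance
  have hsν : SigmaFinite ν := inferInstance
  -- The group is coordinatized by the matrix of `g⁻¹`, the one that acts on Gram matrices, so
  -- measurability of inversion is not needed.
  let _ : MeasurableSpace (V ≃ₗ[ℝ] V) := MeasurableSpace.comap (invMatrix b) inferInstance
  have hi : MeasurableEmbedding (invMatrix b) :=
    { injective := invMatrix_injective b
      measurable := comap_measurable _
      measurableSet_image' := by
        rintro _ ⟨t, ht, rfl⟩
        rw [Set.image_preimage_eq_inter_range, range_invMatrix]
        exact ht.inter isOpen_det_of_ne_zero.measurableSet }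
  let m : Measure (V ≃ₗ[ℝ] V) := volume.comap (invMatrix b)
  have hm : m.map (invMatrix b) = volume.restrict (Set.range (invMatrix b)) := hi.map_comap _
  have hsm : SigmaFinite m := SigmaFinite.of_map m hi.measurable.aemeasurable (by
    rw [hm]; infer_instance)
  refine exists_eq_smul_of_invariant m ?_ (fun a => ?_) ?_ μ ν hμ0 hν0 hμ hν
  · intro h
    have h0 : m Set.univ = 0 := by rw [h]; rfl
    rw [hi.comap_apply, Set.image_univ, range_invMatrix] at h0
    refine isOpen_det_of_ne_zero.measure_ne_zero volume ⟨_, det_invMatrix_ne_zero b 1⟩ h0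
  -- In these coordinates right translation by `a` is left multiplication by `P`, an invertible
  -- linear map, so preimages of Lebesgue null sets are null.
  · let P : Matrix (Fin (Module.finrank ℝ V)) (Fin (Module.finrank ℝ V)) ℝ :=
      Matrix.of (invMatrix b a)
    let T : (Fin (Module.finrank ℝ V) → Fin (Module.finrank ℝ V) → ℝ) →ₗ[ℝ]
        (Fin (Module.finrank ℝ V) → Fin (Module.finrank ℝ V) → ℝ) :=
      { toFun := fun A => Matrix.of.symm (P * Matrix.of A)
        map_add' := fun A B => Matrix.mul_add P (Matrix.of A) (Matrix.of B)
        map_smul' := fun c A => Matrix.mul_smul P c (Matrix.of A) }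
    have hT : ∀ g, invMatrix b (g * a) = T (invMatrix b g) := fun g => invMatrix_mul b g a
    have hTm : Measurable T := T.continuous_of_finiteDimensional.measurable
    have hTdet : LinearMap.det T ≠ 0 := by
      intro h
      have hker := LinearMap.bot_lt_ker_of_det_eq_zero h
      refine hker.ne' (LinearMap.ker_eq_bot'.2 fun A hA => ?_)
      have hu : IsUnit P :=
        (isUnit_iff_isUnit_det _).2 (isUnit_iff_ne_zero.2 (det_invMatrix_ne_zero b a))
      exact hu.mul_left_cancel (b := Matrix.of A) (c := 0) (Eq.trans hA (Matrix.mul_zero P).symm)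
    have hmeas : Measurable fun g : V ≃ₗ[ℝ] V => g * a := by
      rw [measurable_comap_iff]
      simp only [Function.comp_def, hT]
      exact hTm.comp hi.measurable
    refine ⟨hmeas, Measure.AbsolutelyContinuous.mk fun s hs h => ?_⟩
    rw [Measure.map_apply hmeas hs, hi.comap_apply]
    rw [hi.comap_apply] at h
    have hpre : volume (T ⁻¹' (invMatrix b '' s)) = 0 := by
      rw [Measure.addHaar_preimage_linearMap _ hTdet, h, mul_zero]
    refine measure_mono_null ?_ hpre
    rintro _ ⟨g, hg, rfl⟩
    exact ⟨g * a, hg, hT g⟩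
  · have hcomp : Measurable fun q : (V ≃ₗ[ℝ] V) × ScalarProducts V p p' => gram b (q.1 • q.2) := by
      have h : (fun q : (V ≃ₗ[ℝ] V) × ScalarProducts V p p' => gram b (q.1 • q.2)) =
          fun q => congruence (Matrix.of (invMatrix b q.1)) (gram b q.2) :=
        funext fun q => gram_smul b q.1 q.2
      rw [h]
      exact measurable_congruence (hi.measurable.comp measurable_fst)
        (he.measurableEmbedding.measurable.comp measurable_snd)
    exact he.measurableEmbedding.measurable_comp_iff.1 hcomp

/-! ### Existence of the invariant measure -/

/-- The density `|det A| ^ (-d / n)` of the invariant measure. -/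
noncomputable def density (A : symMatrices n) : ENNReal :=
  ENNReal.ofReal (|(toMat A).det| ^ (-densityExponent n))

theorem measurable_density : Measurable (density (n := n)) := by
  have : Measurable fun A : symMatrices n => (toMat A).det := continuous_det.measurable
  exact ENNReal.measurable_ofReal.comp (this.norm.pow_const _)

theorem density_congruence [NeZero n] (P : Matrix (Fin n) (Fin n) ℝ) (hP : P.det ≠ 0)
    (A : symMatrices n) :
    density (congruence P A) * ENNReal.ofReal (congruenceDet P) = density A := by
  rw [density, ← ENNReal.ofReal_mul (by positivity), density, congruenceDet_eq P hP,
    toMat_congruence, det_mul, det_mul, det_transpose, abs_mul, abs_mul,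
    Real.mul_rpow (by positivity) (by positivity), Real.mul_rpow (by positivity) (by positivity),
    sq, Real.mul_rpow (by positivity) (by positivity), Real.rpow_neg (abs_nonneg P.det)]
  have : |P.det| ^ densityExponent n ≠ 0 := (Real.rpow_pos_of_pos (abs_pos.2 hP) _).ne'
  congr 1
  field_simp

/-- The measure `|det A| ^ (-d / n) dA` on symmetric matrices is invariant under congruences. -/
theorem map_congruence_withDensity [NeZero n] (P : Matrix (Fin n) (Fin n) ℝ) (hP : P.det ≠ 0) :
    ((Measure.addHaar : Measure (symMatrices n)).withDensity density).map (congruence P) =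
      (Measure.addHaar : Measure (symMatrices n)).withDensity density := by
  have hmeas : Measurable (congruence P) :=
    (congruence P).continuous_of_finiteDimensional.measurable
  have hpos : 0 < congruenceDet P := by
    rw [congruenceDet_eq P hP]
    exact Real.rpow_pos_of_pos (by positivity) _
  have hdet : LinearMap.det (congruence P) ≠ 0 := abs_pos.1 hpos
  ext s hs
  rw [Measure.map_apply hmeas hs, withDensity_apply _ (hmeas hs), withDensity_apply _ hs]
  -- Change of variables: the Jacobian hidden in the density cancels the inverse Jacobian of the
  -- pushed-forward Lebesgue measure.
  rw [lintegral_congr fun A => (density_congruence P hP A).symm,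
    lintegral_mul_const _ (show Measurable fun A => density (congruence P A) from
      measurable_density.comp hmeas),
    ← setLIntegral_map hs measurable_density hmeas,
    Measure.map_linearMap_addHaar_eq_smul_addHaar _ hdet, Measure.restrict_smul,
    lintegral_smul_measure, smul_eq_mul, mul_comm, ← mul_assoc,
    ← ENNReal.ofReal_mul hpos.le, congruenceDet_apply, abs_inv,
    mul_inv_cancel₀ (abs_ne_zero.2 hdet), ENNReal.ofReal_one, one_mul]

/-- The weighted Lebesgue measure is pulled back along the Gram embedding. Its density is singular
only where the determinant vanishes, off the image of Γ, so the pull-back is locally finite, and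
regularity follows from the topology of Γ. -/
theorem exists_isInvariant [FiniteDimensional ℝ V] (hV : 0 < Module.finrank ℝ V)
    (hp : p + p' = Module.finrank ℝ V) :
    ∃ μ : Measure (ScalarProducts V p p'), μ.Regular ∧ IsInvariant μ ∧ μ ≠ 0 := by
  have : NeZero (Module.finrank ℝ V) := ⟨hV.ne'⟩
  let b := Module.finBasis ℝ V
  have he := isOpenEmbedding_gram (p := p) (p' := p') b
  have hem := he.measurableEmbedding
  have : LocallyCompactSpace (ScalarProducts V p p') := he.locallyCompactSpace
  have : SecondCountableTopology (ScalarProducts V p p') :=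
    he.isInducing.secondCountableTopology
  have : TopologicalSpace.MetrizableSpace (ScalarProducts V p p') :=
    he.isEmbedding.metrizableSpace
  let μ₀ : Measure (symMatrices (Module.finrank ℝ V)) := Measure.addHaar.withDensity density
  let μ : Measure (ScalarProducts V p p') := μ₀.comap (gram b)
  have hfin : IsLocallyFiniteMeasure μ := by
    refine ⟨fun γ => ?_⟩
    have hcont : ContinuousAt (density (n := Module.finrank ℝ V)) (gram b γ) :=
      ENNReal.continuous_ofReal.continuousAt.comp
        (continuous_det.abs.continuousAt.rpow_const (Or.inl (abs_ne_zero.2 (det_gram_ne_zero b γ))))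
    obtain ⟨C, hC⟩ : ∃ C : NNReal, density (gram b γ) < C :=
      ENNReal.lt_iff_exists_nnreal_btwn.1 ENNReal.ofReal_lt_top |>.imp fun _ h => h.1
    obtain ⟨U, hU, hUfin⟩ := (Measure.addHaar (G := symMatrices (Module.finrank ℝ V))).finiteAt_nhds
      (gram b γ)
    obtain ⟨W, hW, hWo, hγW⟩ := mem_nhds_iff.1 (Filter.inter_mem hU (hcont.eventually_lt_const hC))
    refine ⟨gram b ⁻¹' W, (hWo.preimage he.continuous).mem_nhds hγW, ?_⟩
    rw [hem.comap_apply]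
    refine (measure_mono (Set.image_preimage_subset _ _)).trans_lt ?_
    rw [withDensity_apply _ hWo.measurableSet]
    refine (setLIntegral_mono measurable_const fun A hA => (hW hA).2.le).trans_lt ?_
    rw [setLIntegral_const]
    exact ENNReal.mul_lt_top ENNReal.coe_lt_top
      ((measure_mono fun A hA => (hW hA).1).trans_lt hUfin)
  refine ⟨μ, inferInstance, fun g => ?_, fun h => ?_⟩
  · set P := LinearMap.toMatrix b b (g⁻¹ : V ≃ₗ[ℝ] V).toLinearMap with hPdef
    have hP : P.det ≠ 0 := det_invMatrix_ne_zero b g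
    have hPinj : Function.Injective (congruence P) := by
      intro A B hAB
      have := congrArg toMat hAB
      have hu : IsUnit P := (isUnit_iff_isUnit_det _).2 (isUnit_iff_ne_zero.2 hP)
      have hu' : IsUnit Pᵀ := by
        rw [isUnit_iff_isUnit_det, det_transpose]; exact isUnit_iff_ne_zero.2 hP
      exact toMat_injective (hu'.mul_left_cancel (hu.mul_right_cancel this))
    have hmeas : Measurable (congruence P) :=
      (congruence P).continuous_of_finiteDimensional.measurable
    have hgm : Measurable fun γ : ScalarProducts V p p' => g • γ :=
      (continuous_const_smul g).measurable
    ext s hs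
    rw [Measure.map_apply hgm hs, hem.comap_apply, hem.comap_apply]
    -- Rewriting `μ₀` as its own push-forward reduces invariance to an equality of sets.
    conv_rhs => rw [show μ₀ = _ from (map_congruence_withDensity P hP).symm,
      Measure.map_apply hmeas (hem.measurableSet_image.2 hs)]
    congr 1
    ext A
    constructor
    · rintro ⟨γ, hγ, rfl⟩
      exact ⟨g • γ, hγ, gram_smul b g γ⟩
    · rintro ⟨γ, hγ, h⟩
      refine ⟨g⁻¹ • γ, by simpa using hγ, hPinj ?_⟩
      rw [← h, hPdef, ← gram_smul, smul_inv_smul]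
  · obtain ⟨γ₀⟩ := nonempty (V := V) hp
    have h0 : μ Set.univ = 0 := by rw [h]; rfl
    rw [hem.comap_apply, Set.image_univ, withDensity_apply_eq_zero measurable_density] at h0
    -- The density is positive on the image of Γ, so a zero measure would make this nonempty open
    -- set Lebesgue null.
    refine he.isOpen_range.measure_ne_zero Measure.addHaar ⟨gram b γ₀, Set.mem_range_self γ₀⟩
      (measure_mono_null ?_ h0)
    rintro _ ⟨γ, rfl⟩
    refine ⟨?_, Set.mem_range_self γ⟩
    exact (ENNReal.ofReal_pos.2
      (Real.rpow_pos_of_pos (abs_pos.2 (det_gram_ne_zero b γ)) _)).ne'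

end ScalarProducts

theorem proposition2 (V : Type*) [AddCommGroup V] [Module ℝ V] [FiniteDimensional ℝ V]
    (hV : 0 < Module.finrank ℝ V) (p p' : ℕ) (hp : p + p' = Module.finrank ℝ V) :
    (∃ μ : Measure (ScalarProducts V p p'),
      μ.Regular ∧ ScalarProducts.IsInvariant μ ∧ μ ≠ 0) ∧
    ∀ μ ν : Measure (ScalarProducts V p p'),
      μ.Regular → ScalarProducts.IsInvariant μ → μ ≠ 0 →
      ν.Regular → ScalarProducts.IsInvariant ν → ν ≠ 0 →
      ∃ c : NNReal, 0 < c ∧ ν = c • μ := by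
  exact ⟨ScalarProducts.exists_isInvariant hV hp,
    fun μ ν hμr hμ hμ0 hνr hν hν0 =>
      ScalarProducts.exists_eq_smul_of_isInvariant μ ν hμr hμ hμ0 hνr hν hν0⟩
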